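/- Let $0<r<\pi/2$, and let $v_1,v_2,w_1,w_2$ be points of the unit sphere $\mathbb S^2\subset\mathbb R^3$ such that the eight points $\pm v_1,\pm v_2,\pm w_1,\pm w_2$ are distinct. For a point $c\in\mathbb S^2$ let $C_c$ be the circle of spherical radius $r$ centered at $c$. Let $\mu_1$ be the uniform distribution on $C_{v_1}\cup C_{-v_1}\cup C_{v_2}\cup C_{-v_2}$, and let $\mu_2$ be the uniform distribution on $C_{w_1}\cup C_{-w_1}\cup C_{w_2}\cup C_{-w_2}$. The crossing graph of a geodesic drawing of a complete bipartite graph on $\mathbb S^2$ has the edges of the drawing as its vertices, two of them being adjacent if they cross. For finite graphs $H,X$ let $t(H,X)=\hom(H,X)/|V(X)|^{|V(H)|}$. For a graphon $W$ (a symmetric measurable function $[0,1]^2\to[0,1]$) and a graph $H$ on $\{1,\dots,k\}$ let $t(H,W)=\int_{[0,1]^k}\prod_{ij\in E(H)}W(x_i,x_j)\,dx$. A sequence $(X_n)$ of graphs converges to $W$ if $t(H,X_n)\to t(H,W)$ for every finite graph $H$. A graphon $W$ is called a crossing graphon of $(\mu_1,\mu_2)$, written $W=W(\mu_1,\mu_2)$,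 if the following holds with probability $1$, whatever the dependence between different $n$: the crossing graphs of random geodesic drawings $D_n$ of $K_{n,n}$ converge to $W$, where for each $n$ the two parts of $D_n$ consist of $n$ points with law $\mu_1$ and $n$ points with law $\mu_2$, all $2n$ points being independent. For each $n$ let $D_4^{(n)}$ be a blowup drawing of $K_{4n,4n}$: its parts consist of $n$ evenly spaced points on each of the four circles $C_{\pm v_1},C_{\pm v_2}$, and of $n$ evenly spaced points on each of the four circles $C_{\pm w_1},C_{\pm w_2}$, respectively. The rotation of the points on each circle is arbitrary, except that no two of the $8n$ points are antipodal and no three of them lie on a common great circle. Each point of the first part is joined to each point of the second part by a geodesic segment. Then a crossing graphon $W(\mu_1,\mu_2)$ exists. For every such graphon $W(\mu_1,\mu_2)$ and every such sequence of blowup drawings, the crossing graphs of $D_4^{(n)}$ converge as $n\to\infty$, and their limit is $W(\mu_1,\mu_2)$. -/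

import Mathlib

open MeasureTheory Filter Topology
open scoped unitInterval ENNReal

noncomputable section

/-- Euclidean three-space. -/
abbrev E3 : Type := EuclideanSpace ℝ (Fin 3)

/-- The unit sphere in three-space. -/
abbrev S2 : Type := Metric.sphere (0 : E3) 1

/-! ### Geodesic drawings and crossing graphs -/

/-- The relative interior of the geodesic segment joining two non-antipodal points `x`, `y` of the
sphere: the points of the sphere that are positive combinations of `x` and `y`. -/
def openArc (x y : S2) : Set S2 :=
  {z | ∃ s t : ℝ, 0 < s ∧ 0 < t ∧ (z : E3) = s • (x : E3) + t • (y : E3)}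

/-- The crossing graph of the geodesic drawing of the complete bipartite graph whose two parts are
placed at the points `a i` and `b j`: its vertices are the edges `(i, j)` of the drawing, and two
of them are adjacent if they are different and cross (at a point interior to both). -/
def crossingGraph {ι κ : Type} (a : ι → S2) (b : κ → S2) : SimpleGraph (ι × κ) where
  Adj e f := e ≠ f ∧ (openArc (a e.1) (b e.2) ∩ openArc (a f.1) (b f.2)).Nonempty
  symm := ⟨fun _ _ h => ⟨h.1.symm, by rw [Set.inter_comm]; exact h.2⟩⟩
  loopless := ⟨fun _ h => h.1 rfl⟩

/-- No two of the points are antipodal, and no three of them lie on a common great circle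
(that is, on a common plane through the origin). -/
def GeneralPosition {ι : Type} (p : ι → S2) : Prop :=
  (∀ i j, p i ≠ -p j) ∧
    ∀ i j k, i ≠ j → i ≠ k → j ≠ k →
      LinearIndependent ℝ ![(p i : E3), (p j : E3), (p k : E3)]

/-! ### Graph limits -/

/-- The homomorphism density `t(H, G) = hom(H, G) / |G| ^ |H|`. -/
def homDensity {k : ℕ} (H : SimpleGraph (Fin k)) {V : Type} (G : SimpleGraph V) : ℝ :=
  (Nat.card (H →g G) : ℝ) / (Nat.card V : ℝ) ^ k

/-- A graphon: a symmetric measurable function from the unit square to `[0, 1]`. -/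
structure Graphon where
  toFun : I → I → ℝ
  measurable : Measurable (Function.uncurry toFun)
  symm : ∀ x y, toFun x y = toFun y x
  nonneg : ∀ x y, 0 ≤ toFun x y
  le_one : ∀ x y, toFun x y ≤ 1

open scoped Classical in
/-- The homomorphism density `t(H, W)`, the integral over `[0, 1] ^ k` of the product of the
`W (x i) (x j)` over all edges `ij` of `H` (each edge taken once). -/
def Graphon.homDensity (W : Graphon) {k : ℕ} (H : SimpleGraph (Fin k)) : ℝ :=
  ∫ x : Fin k → I, ∏ e : Fin k × Fin k with e.1 < e.2 ∧ H.Adj e.1 e.2, W.toFun (x e.1) (x e.2)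

/-- The sequence of graphs `X n` is convergent with limit `W`: for every finite graph `H`, the
densities `t(H, X n)` converge to `t(H, W)`. -/
def ConvergesToGraphon {V : ℕ → Type} (X : ∀ n, SimpleGraph (V n)) (W : Graphon) : Prop :=
  ∀ (k : ℕ) (H : SimpleGraph (Fin k)),
    Tendsto (fun n => homDensity H (X n)) atTop (𝓝 (W.homDensity H))

/-- `W` is the crossing graphon `W(μ₁, μ₂)`: whenever, for each `n`, the parts of a geodesic
drawing of `K_{n,n}` consist of `n` independent `μ₁`-random points and `n` independent `μ₂`-random
points, all `2n` points being independent, then with probability `1` the crossing graphs of these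
drawings converge to `W`. Nothing is assumed on the dependence between different `n`. -/
def IsCrossingGraphon (μ₁ μ₂ : Measure S2) (W : Graphon) : Prop :=
  ∀ (Ω : Type) [MeasurableSpace Ω] (P : Measure Ω) [IsProbabilityMeasure P]
    (A B : ∀ n : ℕ, Ω → Fin n → S2),
    (∀ n, ProbabilityTheory.HasLaw (fun ω => (A n ω, B n ω))
      ((Measure.pi fun _ => μ₁).prod (Measure.pi fun _ => μ₂)) P) →
    ∀ᵐ ω ∂P, ConvergesToGraphon (fun n => crossingGraph (A n ω) (B n ω)) W

/-! ### Circles on the sphere -/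

/-- The point at angle `θ` of the circle of spherical radius `r` centred at `b 0`. -/
def circlePoint (b : OrthonormalBasis (Fin 3) ℝ E3) (r θ : ℝ) : S2 :=
  ⟨Real.cos r • b 0 + Real.sin r • (Real.cos θ • b 1 + Real.sin θ • b 2), by
    have h0 : inner ℝ (b 0) (b 0) = (1 : ℝ) := by simp
    have h1 : inner ℝ (b 1) (b 1) = (1 : ℝ) := by simp
    have h2 : inner ℝ (b 2) (b 2) = (1 : ℝ) := by simp
    have h01 : inner ℝ (b 0) (b 1) = (0 : ℝ) := b.orthonormal.2 (by decide)
    have h02 : inner ℝ (b 0) (b 2) = (0 : ℝ) := b.orthonormal.2 (by decide)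
    have h12 : inner ℝ (b 1) (b 2) = (0 : ℝ) := b.orthonormal.2 (by decide)
    have h10 : inner ℝ (b 1) (b 0) = (0 : ℝ) := b.orthonormal.2 (by decide)
    have h20 : inner ℝ (b 2) (b 0) = (0 : ℝ) := b.orthonormal.2 (by decide)
    have h21 : inner ℝ (b 2) (b 1) = (0 : ℝ) := b.orthonormal.2 (by decide)
    rw [mem_sphere_zero_iff_norm, ← sq_eq_sq₀ (norm_nonneg _) zero_le_one,
      ← real_inner_self_eq_norm_sq]
    simp only [inner_add_left, inner_add_right, real_inner_smul_left, real_inner_smul_right,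
      h0, h1, h2, h01, h02, h12, h10, h20, h21]
    nlinarith [Real.sin_sq_add_cos_sq r, Real.sin_sq_add_cos_sq θ]⟩

theorem exists_basis_center (c : S2) :
    ∃ b : OrthonormalBasis (Fin 3) ℝ E3, b 0 = (c : E3) := by
  have hc : ‖(c : E3)‖ = 1 := mem_sphere_zero_iff_norm.mp c.2
  have ho : Orthonormal ℝ (({0} : Set (Fin 3)).domRestrict fun _ => (c : E3)) := by
    refine ⟨fun i => hc, fun i j hij => ?_⟩
    exact absurd (Subsingleton.elim i j) hij
  obtain ⟨b, hb⟩ := ho.exists_orthonormalBasis_extension_of_card_eq (by simp)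
  exact ⟨b, hb 0 rfl⟩

/-- The uniform distribution on the circle of spherical radius `r` centred at `c`: the law of the
point at a uniformly random angle. (The choice of the basis, that is, of the direction of angle `0`
and of the orientation, does not affect this law.) -/
def circleUniform (c : S2) (r : ℝ) : Measure S2 :=
  (ProbabilityTheory.cond volume (Set.Ioc 0 (2 * Real.pi))).map
    (circlePoint (exists_basis_center c).choose r)

/-- The uniform distribution on the union of four circles of equal radius `r`. (The circles have
equal lengths, and different ones share at most two points.) -/
def fourCirclesUniform (c : Fin 4 → S2) (r : ℝ) : Measure S2 :=
  (4 : ℝ≥0∞)⁻¹ • ∑ q, circleUniform (c q) r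

/-- The points `p j`, `j < n`, are evenly spaced on the circle of spherical radius `r` centred
at `c`. The position of the first of them on the circle is arbitrary. -/
def EvenlySpaced {n : ℕ} (c : S2) (r : ℝ) (p : Fin n → S2) : Prop :=
  ∃ b : OrthonormalBasis (Fin 3) ℝ E3, b 0 = (c : E3) ∧
    ∀ j : Fin n, p j = circlePoint b r (2 * Real.pi * (j : ℝ) / n)

/-! ### Blowups of antipodal drawings of `K_{4,4}` -/

/-- Two antipodal pairs. -/
def antipodalPairs (v₁ v₂ : S2) : Fin 4 → S2 := ![v₁, -v₁, v₂, -v₂]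

/-- `A`, `B` are the parts of a blowup drawing with `n` vertices per node, of the geodesic drawing
of `K_{4,4}` with parts `c`, `d`: each vertex is replaced with `n` evenly spaced points of the
circle of radius `r` around it, and all `8n` points are in general position. -/
structure IsBlowup (n : ℕ) (c d : Fin 4 → S2) (r : ℝ) (A B : Fin 4 × Fin n → S2) : Prop where
  left : ∀ q, EvenlySpaced (c q) r fun j => A (q, j)
  right : ∀ q, EvenlySpaced (d q) r fun j => B (q, j)
  generalPosition : GeneralPosition (Sum.elim A B)

end

/-!
The empirical measures of the two vertex sets converge weakly to `μ` and `ν`: for random points by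
Hoeffding's inequality and the Borel–Cantelli lemma, for evenly spaced points because their averages
are Riemann sums. The density `t(H, X)` of a crossing graph lies between the masses that a power of
the product of the two empirical measures gives to an open set (tuples of arcs crossing properly
along the edges of `H`) and to a closed set (tuples satisfying the weak form of the sign
conditions). A circle that is not a great circle meets every great circle in finitely many points,
so the two sets differ by a null set of the limit measure, and the portmanteau theorem yields the
same limit for both kinds of drawings. Parametrizing `μ ⊗ ν` by the unit interval turns these limits
into the homomorphism densities of a graphon.
-/

noncomputable section

open scoped Matrix BigOperators
open ProbabilityTheory (HasLaw)

/-! ### The sign conditions for a crossing -/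

/-- The cross product of Euclidean three-space. -/
def cross (x y : E3) : E3 := WithLp.toLp 2 (x.ofLp ⨯₃ y.ofLp)

theorem inner_eq_dotProduct_ofLp (x y : E3) : inner ℝ x y = x.ofLp ⬝ᵥ y.ofLp := by
  rw [EuclideanSpace.inner_eq_star_dotProduct, star_trivial, dotProduct_comm]

theorem continuous_cross {X : Type*} [TopologicalSpace X] {f g : X → E3} (hf : Continuous f)
    (hg : Continuous g) : Continuous fun x => cross (f x) (g x) := by
  simp only [cross, cross_apply]
  fun_prop

theorem inner_cross_rotate (x y z : E3) : inner ℝ (cross x y) z = inner ℝ (cross y z) x := by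
  simp only [inner_eq_dotProduct_ofLp, cross]
  rw [dotProduct_comm, dotProduct_comm _ x.ofLp, triple_product_permutation]

theorem inner_cross_swap (x y z : E3) : inner ℝ (cross x y) z = -inner ℝ (cross y x) z := by
  simp only [inner_eq_dotProduct_ofLp, cross, ← cross_anticomm x.ofLp, neg_dotProduct, neg_neg]

theorem inner_cross_self_left (x y : E3) : inner ℝ (cross x y) x = 0 := by
  rw [inner_eq_dotProduct_ofLp, dotProduct_comm, cross, dot_self_cross]

theorem inner_cross_self_right (x y : E3) : inner ℝ (cross x y) y = 0 := by
  rw [inner_eq_dotProduct_ofLp, dotProduct_comm, cross, dot_cross_self]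

-- Both sides are `(a × b) × (c × d)`.
theorem inner_cross_smul_sub_smul_eq (a b c d : E3) :
    inner ℝ (cross c d) a • b - inner ℝ (cross c d) b • a =
      inner ℝ (cross a b) d • c - inner ℝ (cross a b) c • d := by
  have h := (cross_cross_eq_smul_sub_smul a.ofLp b.ofLp (c.ofLp ⨯₃ d.ofLp)).symm.trans
    (cross_cross_eq_smul_sub_smul' _ c.ofLp d.ofLp)
  simp only [inner_eq_dotProduct_ofLp, cross, dotProduct_comm (c.ofLp ⨯₃ d.ofLp)]
  rw [dotProduct_comm c.ofLp] at h
  exact congrArg (WithLp.toLp 2) h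

/-- The oriented volume spanned by the endpoints of an arc and a third point: its sign tells on
which side of the great circle through the arc the point lies. -/
def arcSide (p : S2 × S2) (x : S2) : ℝ := inner ℝ (cross p.1 p.2) (x : E3)

theorem continuous_arcSide {X : Type*} [TopologicalSpace X] {p : X → S2 × S2} {x : X → S2}
    (hp : Continuous p) (hx : Continuous x) : Continuous fun z => arcSide (p z) (x z) :=
  (continuous_cross (by fun_prop) (by fun_prop)).inner (by fun_prop)

theorem openArc_inter_nonempty_iff {a b c d : S2} :
    (openArc a b ∩ openArc c d).Nonempty ↔ ∃ s t u v : ℝ, 0 < s ∧ 0 < t ∧ 0 < u ∧ 0 < v ∧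
      s • (a : E3) + t • (b : E3) ≠ 0 ∧
      s • (a : E3) + t • (b : E3) = u • (c : E3) + v • (d : E3) := by
  constructor
  · rintro ⟨z, ⟨s, t, hs, ht, hst⟩, u, v, hu, hv, huv⟩
    exact ⟨s, t, u, v, hs, ht, hu, hv, hst ▸ ne_zero_of_mem_unit_sphere z, hst ▸ huv⟩
  · rintro ⟨s, t, u, v, hs, ht, hu, hv, hne, heq⟩
    set z : E3 := s • (a : E3) + t • (b : E3)
    have : 0 < ‖z‖⁻¹ := inv_pos.2 (norm_pos_iff.2 hne)
    refine ⟨⟨‖z‖⁻¹ • z, by simp [norm_smul, hne]⟩,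
      ⟨‖z‖⁻¹ * s, ‖z‖⁻¹ * t, by positivity, by positivity, ?_⟩,
      ⟨‖z‖⁻¹ * u, ‖z‖⁻¹ * v, by positivity, by positivity, ?_⟩⟩
    · simp only [z, smul_add, smul_smul]
    · simp only [heq, smul_add, smul_smul]

/-- The crossing defect of two arcs, given by their endpoints. It is negative if each of the two
great circles separates the endpoints of the other arc and the two arcs lie on the same pair of
opposite intersection points, that is, if the arcs cross properly. -/
def crossingDefect (p q : S2 × S2) : ℝ :=
  max (arcSide q p.1 * arcSide q p.2)
    (max (arcSide p q.1 * arcSide p q.2) (arcSide q p.1 * arcSide p q.1))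

theorem crossingDefect_comm (p q : S2 × S2) : crossingDefect p q = crossingDefect q p := by
  rw [crossingDefect, crossingDefect, max_left_comm, mul_comm (arcSide q p.1) (arcSide p q.1)]

theorem crossingDefect_self (p : S2 × S2) : crossingDefect p p = 0 := by
  simp [crossingDefect, arcSide, inner_cross_self_left, inner_cross_self_right]

theorem continuous_crossingDefect :
    Continuous fun z : (S2 × S2) × (S2 × S2) => crossingDefect z.1 z.2 := by
  refine .max (.mul ?_ ?_) (.max (.mul ?_ ?_) (.mul ?_ ?_)) <;>
    exact continuous_arcSide (by fun_prop) (by fun_prop)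

theorem crossingDefect_ne_zero {p q : S2 × S2} (hp₁ : arcSide q p.1 ≠ 0)
    (hp₂ : arcSide q p.2 ≠ 0) (hq₁ : arcSide p q.1 ≠ 0) (hq₂ : arcSide p q.2 ≠ 0) :
    crossingDefect p q ≠ 0 := by
  unfold crossingDefect
  rcases max_choice (arcSide q p.1 * arcSide q p.2)
    (max (arcSide p q.1 * arcSide p q.2) (arcSide q p.1 * arcSide p q.1)) with h | h <;> rw [h]
  · exact mul_ne_zero hp₁ hp₂
  rcases max_choice (arcSide p q.1 * arcSide p q.2) (arcSide q p.1 * arcSide p q.1) with h | h <;>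
    rw [h]
  · exact mul_ne_zero hq₁ hq₂
  · exact mul_ne_zero hp₁ hq₁

theorem inner_cross_smul_add_smul (a b c : E3) (s t : ℝ) :
    inner ℝ (cross a c) (s • a + t • b) = -(t * inner ℝ (cross a b) c) := by
  rw [inner_add_right, real_inner_smul_right, real_inner_smul_right, inner_cross_self_left,
    inner_cross_rotate a c b, inner_cross_rotate c b a, inner_cross_swap b a]
  ring

theorem openArc_inter_nonempty_of_crossingDefect_neg {p q : S2 × S2} (h : crossingDefect p q < 0) :
    (openArc p.1 p.2 ∩ openArc q.1 q.2).Nonempty := by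
  obtain ⟨hp, hq, hpq⟩ : arcSide q p.1 * arcSide q p.2 < 0 ∧
      arcSide p q.1 * arcSide p q.2 < 0 ∧ arcSide q p.1 * arcSide p q.1 < 0 := by
    simpa only [crossingDefect, max_lt_iff] using h
  have hq₁ : arcSide p q.1 ≠ 0 := right_ne_zero_of_mul hpq.ne
  have hp₁ : 0 < arcSide q p.1 * arcSide q p.1 := mul_self_pos.2 (left_ne_zero_of_mul hpq.ne)
  have hq₂ : 0 < arcSide q p.1 * arcSide p q.2 := by
    have := mul_pos_of_neg_of_neg hq hpq
    nlinarith [mul_self_pos.2 hq₁]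
  refine openArc_inter_nonempty_iff.2 ⟨-(arcSide q p.1 * arcSide q p.2),
    arcSide q p.1 * arcSide q p.1, arcSide q p.1 * arcSide p q.2,
    -(arcSide q p.1 * arcSide p q.1), neg_pos.2 hp, hp₁, hq₂, neg_pos.2 hpq, fun h0 => ?_, ?_⟩
  · have := inner_cross_smul_add_smul p.1 p.2 q.1 (-(arcSide q p.1 * arcSide q p.2))
      (arcSide q p.1 * arcSide q p.1)
    rw [h0, inner_zero_right, zero_eq_neg] at this
    exact mul_ne_zero hp₁.ne' hq₁ this
  · have relation : arcSide q p.1 • (p.2 : E3) - arcSide q p.2 • (p.1 : E3) =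
        arcSide p q.2 • (q.1 : E3) - arcSide p q.1 • (q.2 : E3) :=
      inner_cross_smul_sub_smul_eq _ _ _ _
    linear_combination (norm := module) arcSide q p.1 • relation

theorem mul_nonpos_of_pos_combination_eq_zero {s t x y : ℝ} (hs : 0 < s) (ht : 0 < t)
    (h : s * x + t * y = 0) : x * y ≤ 0 := by
  have : t * (x * y) = -(s * (x * x)) := by linear_combination x * h
  nlinarith [mul_self_nonneg x]

theorem crossingDefect_nonpos_of_openArc_inter_nonempty {p q : S2 × S2}
    (h : (openArc p.1 p.2 ∩ openArc q.1 q.2).Nonempty) : crossingDefect p q ≤ 0 := by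
  obtain ⟨s, t, u, v, hs, ht, hu, hv, -, heq⟩ := openArc_inter_nonempty_iff.1 h
  have hp : s * arcSide q p.1 + t * arcSide q p.2 = 0 := by
    simpa [arcSide, inner_add_right, real_inner_smul_right, inner_cross_self_left,
      inner_cross_self_right] using congrArg (inner ℝ (cross q.1 q.2)) heq
  have hq : u * arcSide p q.1 + v * arcSide p q.2 = 0 := by
    simpa [arcSide, inner_add_right, real_inner_smul_right, inner_cross_self_left,
      inner_cross_self_right] using congrArg (inner ℝ (cross p.1 p.2)) heq.symm
  have hpq : v * arcSide q p.1 + t * arcSide p q.1 = 0 := by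
    have := congrArg (inner ℝ (cross p.1 q.1)) heq
    rw [inner_cross_smul_add_smul, inner_add_right, real_inner_smul_right, real_inner_smul_right,
      inner_cross_self_right, inner_cross_rotate (p.1 : E3) q.1] at this
    simp only [arcSide]
    linarith
  exact max_le (mul_nonpos_of_pos_combination_eq_zero hs ht hp)
    (max_le (mul_nonpos_of_pos_combination_eq_zero hu hv hq)
      (mul_nonpos_of_pos_combination_eq_zero hv ht hpq))

/-! ### Measures that do not charge great circles -/

/-- The measure gives mass zero to every great circle. -/
def NullOnGreatCircles (μ : Measure S2) : Prop :=
  ∀ n : E3, n ≠ 0 → ∀ᵐ x : S2 ∂μ, inner ℝ n (x : E3) ≠ 0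

theorem exists_cross_ne_zero {x : E3} (hx : x ≠ 0) : ∃ y, cross x y ≠ 0 := by
  obtain ⟨y, hy⟩ := exists_linearIndependent_pair_of_one_lt_finrank (R := ℝ) (by simp)
    ((WithLp.ofLp_eq_zero 2).not.2 hx)
  exact ⟨WithLp.toLp 2 y,
    (WithLp.toLp_eq_zero 2).not.2 (crossProduct_ne_zero_iff_linearIndependent.2 hy)⟩

namespace NullOnGreatCircles

variable {μ ν : Measure S2}

theorem ae_cross_ne_zero (hμ : NullOnGreatCircles μ) {x : E3} (hx : x ≠ 0) :
    ∀ᵐ y : S2 ∂μ, cross x y ≠ 0 := by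
  obtain ⟨e, he⟩ := exists_cross_ne_zero hx
  filter_upwards [hμ _ he] with y hy hxy
  rw [inner_cross_rotate, inner_cross_rotate, inner_cross_swap, hxy] at hy
  simp at hy

theorem ae_prod_cross_ne_zero [SFinite μ] [SFinite ν] (hν : NullOnGreatCircles ν) :
    ∀ᵐ p ∂μ.prod ν, cross (p.1 : E3) p.2 ≠ 0 := by
  have hcont : Continuous fun p : S2 × S2 => cross (p.1 : E3) p.2 :=
    continuous_cross (by fun_prop) (by fun_prop)
  have hmeas : MeasurableSet {p : S2 × S2 | cross (p.1 : E3) p.2 ≠ 0} :=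
    (hcont.measurable (measurableSet_singleton 0)).compl
  refine (Measure.ae_prod_iff_ae_ae hmeas).2 (ae_of_all _ fun a => ?_)
  filter_upwards [hν.ae_cross_ne_zero (ne_zero_of_mem_unit_sphere a)] with b hb using hb

theorem ae_arcSide_ne_zero [SFinite μ] [SFinite ν] (hμ : NullOnGreatCircles μ)
    (hν : NullOnGreatCircles ν) : ∀ᵐ z ∂(μ.prod ν).prod (μ.prod ν),
      arcSide z.1 z.2.1 ≠ 0 ∧ arcSide z.1 z.2.2 ≠ 0 := by
  have hmeas {f : S2 × S2 → S2} (hf : Continuous f) :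
      MeasurableSet {z : (S2 × S2) × (S2 × S2) | arcSide z.1 (f z.2) ≠ 0} :=
    have hcont := continuous_arcSide continuous_fst (hf.comp continuous_snd)
    (hcont.measurable (measurableSet_singleton 0)).compl
  have hfst : ∀ᵐ z ∂(μ.prod ν).prod (μ.prod ν), arcSide z.1 z.2.1 ≠ 0 := by
    refine (Measure.ae_prod_iff_ae_ae (hmeas continuous_fst)).2 ?_
    filter_upwards [ae_prod_cross_ne_zero hν] with p hp
    have h : ∀ᵐ x ∂μ, arcSide p x ≠ 0 := hμ _ hp
    exact Measure.quasiMeasurePreserving_fst.ae h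
  have hsnd : ∀ᵐ z ∂(μ.prod ν).prod (μ.prod ν), arcSide z.1 z.2.2 ≠ 0 := by
    refine (Measure.ae_prod_iff_ae_ae (hmeas continuous_snd)).2 ?_
    filter_upwards [ae_prod_cross_ne_zero hν] with p hp
    have h : ∀ᵐ x ∂ν, arcSide p x ≠ 0 := hν _ hp
    exact Measure.quasiMeasurePreserving_snd.ae h
  exact hfst.and hsnd

theorem ae_crossingDefect_ne_zero [SFinite μ] [SFinite ν] (hμ : NullOnGreatCircles μ)
    (hν : NullOnGreatCircles ν) :
    ∀ᵐ z ∂(μ.prod ν).prod (μ.prod ν), crossingDefect z.1 z.2 ≠ 0 := by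
  have hsides := hμ.ae_arcSide_ne_zero hν
  filter_upwards [hsides, Measure.measurePreserving_swap.quasiMeasurePreserving.ae hsides]
    with z hq hp
  exact crossingDefect_ne_zero hp.1 hp.2 hq.1 hq.2

end NullOnGreatCircles

/-! ### Homomorphisms into a relation -/

section HomSet

variable {V X : Type*}

/-- The maps from the vertices of `H` that send every edge of `H` into the relation `R`. -/
def homSet (H : SimpleGraph V) (R : Set (X × X)) : Set (V → X) :=
  {x | ∀ i j, H.Adj i j → (x i, x j) ∈ R}

theorem homSet_eq_iInter (H : SimpleGraph V) (R : Set (X × X)) :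
    homSet H R = ⋂ i, ⋂ j, ⋂ _ : H.Adj i j, (fun x => (x i, x j)) ⁻¹' R := by
  simp only [homSet, Set.ofPred_forall, Set.preimage]

theorem homSet_mono (H : SimpleGraph V) {R S : Set (X × X)} (h : R ⊆ S) :
    homSet H R ⊆ homSet H S :=
  fun _ hx i j hij => h (hx i j hij)

theorem isOpen_homSet [TopologicalSpace X] [Finite V] (H : SimpleGraph V) {R : Set (X × X)}
    (hR : IsOpen R) : IsOpen (homSet H R) := by
  rw [homSet_eq_iInter]
  exact isOpen_iInter_of_finite fun i => isOpen_iInter_of_finite fun j =>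
    isOpen_iInter_of_finite fun _ => hR.preimage (by fun_prop)

theorem isClosed_homSet [TopologicalSpace X] (H : SimpleGraph V) {R : Set (X × X)}
    (hR : IsClosed R) : IsClosed (homSet H R) := by
  rw [homSet_eq_iInter]
  exact isClosed_iInter fun i => isClosed_iInter fun j =>
    isClosed_iInter fun _ => hR.preimage (by fun_prop)

variable [MeasurableSpace X]

theorem measurableSet_homSet [Countable V] (H : SimpleGraph V) {R : Set (X × X)}
    (hR : MeasurableSet R) : MeasurableSet (homSet H R) := by
  rw [homSet_eq_iInter]
  exact .iInter fun i => .iInter fun j => .iInter fun _ =>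
    ((measurable_pi_apply i).prodMk (measurable_pi_apply j)) hR

theorem measurePreserving_eval_prodMk {ι : Type*} [Fintype ι] {X : ι → Type*}
    [∀ i, MeasurableSpace (X i)] (μ : ∀ i, Measure (X i)) [∀ i, IsProbabilityMeasure (μ i)]
    {i j : ι} (hij : i ≠ j) :
    MeasurePreserving (fun x : ∀ i, X i => (x i, x j)) (Measure.pi μ) ((μ i).prod (μ j)) := by
  have hind := (ProbabilityTheory.iIndepFun_pi (μ := μ) (X := fun _ => id)
    fun _ => aemeasurable_id).indepFun hij
  refine ⟨by fun_prop, (hind.map_prod_eq_prod_map_map (measurable_pi_apply i).aemeasurable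
    (measurable_pi_apply j).aemeasurable).trans ?_⟩
  exact congrArg₂ Measure.prod (measurePreserving_eval μ i).map_eq
    (measurePreserving_eval μ j).map_eq

theorem measure_homSet_diff_eq_zero [Fintype V] (H : SimpleGraph V) {μ : Measure X}
    [IsProbabilityMeasure μ] {R S : Set (X × X)} (h : (μ.prod μ) (R \ S) = 0) :
    Measure.pi (fun _ => μ) (homSet H R \ homSet H S) = 0 := by
  have hpair : ∀ᵐ x ∂Measure.pi (fun _ : V => μ), ∀ i j, i ≠ j → (x i, x j) ∉ R \ S :=
    ae_all_iff.2 fun i => ae_all_iff.2 fun j => ae_all_iff.2 fun hij =>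
      (measurePreserving_eval_prodMk (fun _ => μ) hij).quasiMeasurePreserving.ae
        (measure_eq_zero_iff_ae_notMem.1 h)
  rw [measure_eq_zero_iff_ae_notMem]
  filter_upwards [hpair] with x hx hxRS
  exact hxRS.2 fun i j hij => by_contra fun hS => hx i j hij.ne ⟨hxRS.1 i j hij, hS⟩

end HomSet

/-- The pairs of arcs that cross properly. -/
def properCrossings : Set ((S2 × S2) × (S2 × S2)) := {z | crossingDefect z.1 z.2 < 0}

/-- The closed set of pairs of arcs that satisfy the weak form of the sign conditions for a
crossing. It contains all pairs of arcs that meet, and also degenerate pairs. -/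
def weakCrossings : Set ((S2 × S2) × (S2 × S2)) := {z | crossingDefect z.1 z.2 ≤ 0}

theorem isOpen_properCrossings : IsOpen properCrossings :=
  isOpen_lt continuous_crossingDefect continuous_const

theorem isClosed_weakCrossings : IsClosed weakCrossings :=
  isClosed_le continuous_crossingDefect continuous_const

theorem NullOnGreatCircles.measure_weakCrossings_diff_properCrossings {μ ν : Measure S2}
    [SFinite μ] [SFinite ν] (hμ : NullOnGreatCircles μ) (hν : NullOnGreatCircles ν) :
    ((μ.prod ν).prod (μ.prod ν)) (weakCrossings \ properCrossings) = 0 := by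
  rw [measure_eq_zero_iff_ae_notMem]
  filter_upwards [hμ.ae_crossingDefect_ne_zero hν] with z hz hdiff
  exact hz (le_antisymm hdiff.1 (not_lt.1 hdiff.2))

/-! ### Empirical measures -/

section Empirical

variable {X Y ι κ : Type*} [MeasurableSpace X] [MeasurableSpace Y] [Fintype ι] [Fintype κ]

/-- The uniform distribution on a finite family of points, counted with multiplicities. -/
def empiricalMeasure (p : ι → X) : Measure X :=
  (Fintype.card ι : ℝ≥0∞)⁻¹ • ∑ i, Measure.dirac (p i)

theorem empiricalMeasure_apply (p : ι → X) {s : Set X} [DecidablePred (p · ∈ s)]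
    (hs : MeasurableSet s) :
    empiricalMeasure p s = (Fintype.card ι : ℝ≥0∞)⁻¹ * Fintype.card {i // p i ∈ s} := by
  simp [empiricalMeasure, Measure.dirac_apply' _ hs, Set.indicator_apply, Finset.sum_boole,
    Fintype.card_subtype]

theorem integral_empiricalMeasure (p : ι → X) {f : X → ℝ} (hf : StronglyMeasurable f) :
    ∫ x, f x ∂empiricalMeasure p = 𝔼 i, f (p i) := by
  rw [empiricalMeasure, integral_smul_measure,
    integral_finsetSum_measure fun i _ => integrable_dirac' hf (by simp),
    Fintype.expect_eq_sum_div_card, div_eq_inv_mul]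
  simp [integral_dirac' _ _ hf]

variable [Nonempty ι] [Nonempty κ]

instance isProbabilityMeasure_empiricalMeasure (p : ι → X) :
    IsProbabilityMeasure (empiricalMeasure p) where
  measure_univ := by simp [empiricalMeasure, ENNReal.inv_mul_cancel]

/-- The empirical measure as a bundled probability measure. -/
def empiricalProb (p : ι → X) : ProbabilityMeasure X := ⟨empiricalMeasure p, inferInstance⟩

theorem empiricalMeasure_prod (p : ι → X) (q : κ → Y) :
    (empiricalMeasure p).prod (empiricalMeasure q) = empiricalMeasure (Prod.map p q) := by
  classical
  refine Measure.prod_eq fun s t hs ht => ?_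
  have hcard : Fintype.card {z : ι × κ // Prod.map p q z ∈ s ×ˢ t} =
      Fintype.card {i // p i ∈ s} * Fintype.card {j // q j ∈ t} := by
    rw [← Fintype.card_prod]
    exact Fintype.card_congr
      (Equiv.subtypeProdEquivProd (p := (p · ∈ s)) (q := (q · ∈ t)))
  rw [empiricalMeasure_apply _ (hs.prod ht), empiricalMeasure_apply _ hs,
    empiricalMeasure_apply _ ht, hcard, Fintype.card_prod, Nat.cast_mul, Nat.cast_mul,
    ENNReal.mul_inv (by simp) (by simp)]
  ring

theorem empiricalMeasure_pi {V : Type*} [Fintype V] [DecidableEq V] (p : ι → X) :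
    Measure.pi (fun _ : V => empiricalMeasure p) = empiricalMeasure fun g : V → ι => p ∘ g := by
  classical
  refine Measure.pi_eq fun s hs => ?_
  have hcard : Fintype.card {g : V → ι // p ∘ g ∈ Set.univ.pi s} =
      ∏ v, Fintype.card {i // p i ∈ s v} := by
    rw [← Fintype.card_pi]
    exact Fintype.card_congr ((Equiv.subtypeEquivRight fun g => by simp).trans
      Equiv.subtypePiEquivPi)
  simp only [empiricalMeasure_apply _ (MeasurableSet.univ_pi hs), empiricalMeasure_apply _ (hs _),
    hcard, Finset.prod_mul_distrib, Finset.prod_const, Finset.card_univ, Fintype.card_fun,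
    Nat.cast_prod, Nat.cast_pow, ENNReal.inv_pow]

theorem empiricalMeasure_pi_homSet {k : ℕ} (p : ι → X) (H : SimpleGraph (Fin k))
    {R : Set (X × X)} (hR : MeasurableSet R) :
    (Measure.pi fun _ : Fin k => empiricalMeasure p).real (homSet H R) =
      Nat.card {g : Fin k → ι // p ∘ g ∈ homSet H R} / Nat.card ι ^ k := by
  classical
  rw [empiricalMeasure_pi, Measure.real, empiricalMeasure_apply _ (measurableSet_homSet H hR)]
  simp [div_eq_inv_mul, Nat.card_eq_fintype_card]

end Empirical

section HomDensity

variable {V X : Type} [MeasurableSpace X] [Fintype V] [Nonempty V] {k : ℕ}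
  (H : SimpleGraph (Fin k)) {G : SimpleGraph V} {p : V → X} {R : Set (X × X)}

theorem measureReal_homSet_le_homDensity (hR : MeasurableSet R)
    (h : ∀ u v, (p u, p v) ∈ R → G.Adj u v) :
    (Measure.pi fun _ : Fin k => empiricalMeasure p).real (homSet H R) ≤ homDensity H G := by
  rw [empiricalMeasure_pi_homSet p H hR, homDensity]
  gcongr
  refine Nat.card_le_card_of_injective
    (fun g => (⟨g.1, fun {i j} hij => h _ _ (g.2 i j hij)⟩ : H →g G)) fun g g' hgg' => ?_
  exact Subtype.ext (congrArg DFunLike.coe hgg')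

theorem homDensity_le_measureReal_homSet (hR : MeasurableSet R)
    (h : ∀ u v, G.Adj u v → (p u, p v) ∈ R) :
    homDensity H G ≤ (Measure.pi fun _ : Fin k => empiricalMeasure p).real (homSet H R) := by
  rw [empiricalMeasure_pi_homSet p H hR, homDensity]
  gcongr
  refine Nat.card_le_card_of_injective
    (fun g : H →g G => ⟨g, fun i j hij => h _ _ (g.map_rel hij)⟩) fun g g' hgg' => ?_
  exact DFunLike.coe_injective (congrArg Subtype.val hgg')

end HomDensity

theorem tendsto_of_measureReal_isOpen_le_of_le_measureReal_isClosed {X : Type*}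
    [TopologicalSpace X] [MeasurableSpace X] [OpensMeasurableSpace X] [HasOuterApproxClosed X]
    {ι : Type*} {l : Filter ι} {M : ι → ProbabilityMeasure X} {M₀ : ProbabilityMeasure X}
    (hM : Tendsto M l (𝓝 M₀)) {U F : Set X} (hU : IsOpen U) (hF : IsClosed F) (hUF : U ⊆ F)
    (hnull : (M₀ : Measure X) (F \ U) = 0) {t : ι → ℝ}
    (hle : ∀ n, (M n : Measure X).real U ≤ t n) (hge : ∀ n, t n ≤ (M n : Measure X).real F) :
    Tendsto t l (𝓝 ((M₀ : Measure X).real U)) := by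
  have hopen := ProbabilityMeasure.le_liminf_measure_open_of_tendsto hM hU
  have hclosed := ProbabilityMeasure.limsup_measure_closed_le_of_tendsto hM hF
  have hlower := tendsto_measure_of_le_liminf_measure_of_limsup_measure_le subset_rfl hUF hnull
    hopen hclosed
  have hupper := tendsto_measure_of_le_liminf_measure_of_limsup_measure_le hUF subset_rfl hnull
    hopen hclosed
  rw [show (M₀ : Measure X) F = (M₀ : Measure X) U from
    le_antisymm (measure_mono_ae (ae_le_set.2 hnull)) (measure_mono hUF)] at hupper
  exact tendsto_of_tendsto_of_tendsto_of_le_of_le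
    ((ENNReal.tendsto_toReal (measure_ne_top _ _)).comp hlower)
    ((ENNReal.tendsto_toReal (measure_ne_top _ _)).comp hupper) hle hge

theorem tendsto_homDensity_of_tendsto_empiricalProb {X : Type} [TopologicalSpace X]
    [SecondCountableTopology X] [TopologicalSpace.PseudoMetrizableSpace X] [MeasurableSpace X]
    [OpensMeasurableSpace X] {V : ℕ → Type} [∀ n, Fintype (V n)] [∀ n, Nonempty (V n)]
    {p : ∀ n, V n → X} {μ : ProbabilityMeasure X}
    (hp : Tendsto (fun n => empiricalProb (p n)) atTop (𝓝 μ)) {R S : Set (X × X)}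
    (hR : IsOpen R) (hS : IsClosed S) (hRS : R ⊆ S)
    (hnull : ((μ : Measure X).prod (μ : Measure X)) (S \ R) = 0)
    {G : ∀ n, SimpleGraph (V n)} (hRG : ∀ n u v, (p n u, p n v) ∈ R → (G n).Adj u v)
    (hGS : ∀ n u v, (G n).Adj u v → (p n u, p n v) ∈ S) {k : ℕ} (H : SimpleGraph (Fin k)) :
    Tendsto (fun n => homDensity H (G n)) atTop
      (𝓝 ((Measure.pi fun _ : Fin k => (μ : Measure X)).real (homSet H R))) := by
  have hpi : Tendsto (fun n => ProbabilityMeasure.pi fun _ : Fin k => empiricalProb (p n)) atTop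
      (𝓝 (ProbabilityMeasure.pi fun _ : Fin k => μ)) :=
    (ProbabilityMeasure.continuous_pi.tendsto fun _ : Fin k => μ).comp
      (tendsto_pi_nhds.2 fun _ => hp)
  exact tendsto_of_measureReal_isOpen_le_of_le_measureReal_isClosed hpi (isOpen_homSet H hR)
    (isClosed_homSet H hS) (homSet_mono H hRS) (measure_homSet_diff_eq_zero H hnull)
    (fun n => measureReal_homSet_le_homDensity H hR.measurableSet (hRG n))
    (fun n => homDensity_le_measureReal_homSet H hS.measurableSet (hGS n))

/-- The homomorphism density of `H` in the crossing graph of the arcs whose two endpoints are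
distributed according to `μ` and `ν`. -/
def crossingDensity (μ ν : Measure S2) {k : ℕ} (H : SimpleGraph (Fin k)) : ℝ :=
  (Measure.pi fun _ : Fin k => μ.prod ν).real (homSet H properCrossings)

theorem properCrossings_subset_weakCrossings : properCrossings ⊆ weakCrossings :=
  Set.ofPred_subset_ofPred.2 fun _ => le_of_lt

section CrossingGraph

variable {ι κ : Type} (a : ι → S2) (b : κ → S2) (e f : ι × κ)

theorem crossingGraph_adj_of_mem_properCrossings
    (h : (Prod.map a b e, Prod.map a b f) ∈ properCrossings) : (crossingGraph a b).Adj e f := by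
  refine ⟨?_, openArc_inter_nonempty_of_crossingDefect_neg h⟩
  rintro rfl
  exact h.ne (crossingDefect_self _)

theorem mem_weakCrossings_of_crossingGraph_adj (h : (crossingGraph a b).Adj e f) :
    (Prod.map a b e, Prod.map a b f) ∈ weakCrossings :=
  crossingDefect_nonpos_of_openArc_inter_nonempty h.2

end CrossingGraph

theorem tendsto_homDensity_crossingGraph_of_tendsto_empiricalProb {ι κ : ℕ → Type}
    [∀ n, Fintype (ι n)] [∀ n, Fintype (κ n)] [∀ n, Nonempty (ι n)] [∀ n, Nonempty (κ n)]
    {a : ∀ n, ι n → S2} {b : ∀ n, κ n → S2} {μ ν : ProbabilityMeasure S2}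
    (hμ : NullOnGreatCircles (μ : Measure S2)) (hν : NullOnGreatCircles (ν : Measure S2))
    (ha : Tendsto (fun n => empiricalProb (a n)) atTop (𝓝 μ))
    (hb : Tendsto (fun n => empiricalProb (b n)) atTop (𝓝 ν)) {k : ℕ} (H : SimpleGraph (Fin k)) :
    Tendsto (fun n => homDensity H (crossingGraph (a n) (b n))) atTop
      (𝓝 (crossingDensity μ ν H)) := by
  have hab : Tendsto (fun n => empiricalProb (Prod.map (a n) (b n))) atTop (𝓝 (μ.prod ν)) := by
    refine ((ProbabilityMeasure.continuous_prod.tendsto (μ, ν)).comp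
      (ha.prodMk_nhds hb)).congr fun n => ?_
    exact Subtype.ext (empiricalMeasure_prod (a n) (b n))
  exact tendsto_homDensity_of_tendsto_empiricalProb hab isOpen_properCrossings
    isClosed_weakCrossings properCrossings_subset_weakCrossings
    (hμ.measure_weakCrossings_diff_properCrossings hν)
    (fun n => crossingGraph_adj_of_mem_properCrossings (a n) (b n))
    (fun n => mem_weakCrossings_of_crossingGraph_adj (a n) (b n)) H

/-! ### Equidistribution -/

section Equidistribution

theorem lipschitzWith_expect {X : Type*} [TopologicalSpace X] [CompactSpace X] {κ : Type*}
    [Fintype κ] (q : κ → X) :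
    LipschitzWith 1 fun f : C(X, ℝ) => 𝔼 i, f (q i) := by
  refine LipschitzWith.mk_one fun f g => ?_
  rw [Real.dist_eq, ← Finset.expect_sub_distrib]
  refine (Finset.abs_expect_le _ _).trans ?_
  cases isEmpty_or_nonempty κ
  · simp
  · exact Finset.expect_le Finset.univ_nonempty fun i _ => (f.dist_apply_le_dist (g := g) (q i))

variable {X : Type*} [TopologicalSpace X] [MeasurableSpace X]

/-- The finite families `p n` of points of the compact space `X` are asymptotically distributed
according to `μ`: the averages of every continuous test function converge to its integral. -/
def IsEquidistributed {ι : ℕ → Type*} [∀ n, Fintype (ι n)] (p : ∀ n, ι n → X) (μ : Measure X) :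
    Prop :=
  ∀ f : C(X, ℝ), Tendsto (fun n => 𝔼 i, f (p n i)) atTop (𝓝 (∫ x, f x ∂μ))

theorem IsEquidistributed.comp_add_one {ι : ℕ → Type*} [∀ n, Fintype (ι n)] {p : ∀ n, ι n → X}
    {μ : Measure X} (h : IsEquidistributed p μ) : IsEquidistributed (fun n => p (n + 1)) μ :=
  fun f => (h f).comp (tendsto_add_atTop_nat 1)

variable [OpensMeasurableSpace X] {ι : ℕ → Type*} [∀ n, Fintype (ι n)]

theorem IsEquidistributed.tendsto_empiricalProb [∀ n, Nonempty (ι n)] {p : ∀ n, ι n → X}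
    {μ : ProbabilityMeasure X} (h : IsEquidistributed p μ) :
    Tendsto (fun n => empiricalProb (p n)) atTop (𝓝 μ) := by
  refine ProbabilityMeasure.tendsto_iff_forall_integral_tendsto.2 fun f => ?_
  refine (h f.toContinuousMap).congr fun n => ?_
  exact (integral_empiricalMeasure (p n) f.continuous.stronglyMeasurable).symm

variable [CompactSpace X]

theorem continuous_integral_continuousMap (μ : Measure X) [IsFiniteMeasure μ] :
    Continuous fun f : C(X, ℝ) => ∫ x, f x ∂μ := by
  have hint (f : C(X, ℝ)) : Integrable f μ :=
    f.continuous.integrable_of_hasCompactSupport (.of_compactSpace f)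
  refine (LipschitzWith.of_dist_le' (K := μ.real Set.univ) fun f g => ?_).continuous
  rw [dist_eq_norm, dist_eq_norm, ← integral_sub (hint f) (hint g), mul_comm]
  exact norm_integral_le_of_norm_le_const (ae_of_all _ (f - g).norm_coe_le_norm)

theorem isEquidistributed_of_dense {p : ∀ n, ι n → X} {μ : Measure X} [IsFiniteMeasure μ]
    {D : Set C(X, ℝ)} (hD : Dense D)
    (h : ∀ f ∈ D, Tendsto (fun n => 𝔼 i, f (p n i)) atTop (𝓝 (∫ x, f x ∂μ))) :
    IsEquidistributed p μ := by
  have hclosed : IsClosed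
      {f : C(X, ℝ) | Tendsto (fun n => 𝔼 i, f (p n i)) atTop (𝓝 (∫ x, f x ∂μ))} :=
    (LipschitzWith.uniformEquicontinuous _ 1 fun n =>
      lipschitzWith_expect (p n)).equicontinuous.isClosed_setOfPred_tendsto
        (continuous_integral_continuousMap μ)
  exact fun f => hclosed.closure_subset_iff.2 h (hD f)

end Equidistribution

theorem IsEquidistributed.tendsto_homDensity_crossingGraph {ι κ : ℕ → Type} [∀ n, Fintype (ι n)]
    [∀ n, Fintype (κ n)] [∀ n, Nonempty (ι (n + 1))] [∀ n, Nonempty (κ (n + 1))]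
    {a : ∀ n, ι n → S2} {b : ∀ n, κ n → S2} {μ ν : Measure S2} [IsProbabilityMeasure μ]
    [IsProbabilityMeasure ν] (hμ : NullOnGreatCircles μ) (hν : NullOnGreatCircles ν)
    (ha : IsEquidistributed a μ) (hb : IsEquidistributed b ν) {k : ℕ} (H : SimpleGraph (Fin k)) :
    Tendsto (fun n => homDensity H (crossingGraph (a n) (b n))) atTop
      (𝓝 (crossingDensity μ ν H)) :=
  (tendsto_add_atTop_iff_nat 1).1 <|
    tendsto_homDensity_crossingGraph_of_tendsto_empiricalProb (μ := ⟨μ, ‹_›⟩) (ν := ⟨ν, ‹_›⟩) hμ hν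
      ha.comp_add_one.tendsto_empiricalProb hb.comp_add_one.tendsto_empiricalProb H

/-! ### Random points -/

section Random

variable {X : Type*} [MeasurableSpace X] {μ : Measure X} [IsProbabilityMeasure μ]

theorem hasSubgaussianMGF_eval_sub_integral {ι : Type*} [Fintype ι] {f : X → ℝ} {a b : ℝ}
    (hf : AEMeasurable f μ) (hab : ∀ᵐ x ∂μ, f x ∈ Set.Icc a b) (i : ι) :
    ProbabilityTheory.HasSubgaussianMGF (fun x : ι → X => f (x i) - ∫ y, f y ∂μ)
      ((‖b - a‖₊ / 2) ^ 2) (Measure.pi fun _ => μ) := by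
  have heval := measurePreserving_eval (fun _ : ι => μ) i
  have h := ProbabilityTheory.hasSubgaussianMGF_of_mem_Icc
    (hf.comp_quasiMeasurePreserving heval.quasiMeasurePreserving)
    (heval.quasiMeasurePreserving.ae hab)
  simpa only [Function.comp_apply, Function.eval, integral_comp_eval (μ := fun _ : ι => μ) (i := i)
    hf.aestronglyMeasurable] using h

theorem measureReal_expect_sub_integral_ge_le {ι : Type*} [Fintype ι] {f : X → ℝ} {a b ε : ℝ}
    (hf : AEMeasurable f μ) (hab : ∀ᵐ x ∂μ, f x ∈ Set.Icc a b) (hε : 0 ≤ ε) :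
    (Measure.pi fun _ : ι => μ).real {x | ε ≤ 𝔼 i, f (x i) - ∫ y, f y ∂μ} ≤
      Real.exp (Fintype.card ι * -(2 * ε ^ 2 / (b - a) ^ 2)) := by
  cases isEmpty_or_nonempty ι
  · simp
  have hn : (0 : ℝ) < Fintype.card ι := Nat.cast_pos.2 Fintype.card_pos
  have hind : ProbabilityTheory.iIndepFun
      (fun (i : ι) (x : ι → X) => f (x i) - ∫ y, f y ∂μ) (Measure.pi fun _ => μ) :=
    ProbabilityTheory.iIndepFun_pi (X := fun _ x => f x - ∫ y, f y ∂μ) fun _ => hf.sub_const _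
  have hset : {x : ι → X | ε ≤ 𝔼 i, f (x i) - ∫ y, f y ∂μ} =
      {x | Fintype.card ι * ε ≤ ∑ i, (f (x i) - ∫ y, f y ∂μ)} := by
    ext x
    simp only [Set.mem_ofPred_eq, Finset.sum_sub_distrib, Finset.sum_const, Finset.card_univ,
      nsmul_eq_mul, Fintype.expect_eq_sum_div_card]
    rw [← mul_le_mul_iff_right₀ hn, mul_sub, mul_div_cancel₀ _ hn.ne']
  rw [hset]
  refine (ProbabilityTheory.HasSubgaussianMGF.measure_sum_ge_le_of_iIndepFun hind
    (fun i _ => hasSubgaussianMGF_eval_sub_integral hf hab i) (by positivity)).trans_eq ?_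
  congr 1
  simp only [Finset.sum_const, Finset.card_univ, nsmul_eq_mul, NNReal.coe_mul, NNReal.coe_natCast,
    NNReal.coe_pow, NNReal.coe_div, coe_nnnorm, Real.norm_eq_abs, NNReal.coe_ofNat, div_pow, sq_abs]
  field_simp

variable {Ω : Type*} [MeasurableSpace Ω] {P : Measure Ω} {A : ∀ n : ℕ, Ω → Fin n → X}

theorem ae_eventually_expect_sub_integral_lt
    (hA : ∀ n, HasLaw (A n) (Measure.pi fun _ => μ) P) {f : X → ℝ} (hf : Measurable f) {C ε : ℝ}
    (hC : ∀ x, |f x| ≤ C) (hε : 0 < ε) :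
    ∀ᵐ ω ∂P, ∀ᶠ n in atTop, 𝔼 i, f (A n ω i) - ∫ y, f y ∂μ < ε := by
  have hC₀ : 0 ≤ C :=
    have := nonempty_of_isProbabilityMeasure μ
    (abs_nonneg _).trans (hC (Classical.arbitrary X))
  set c : ℝ := -(2 * ε ^ 2 / (C + 1 - -(C + 1)) ^ 2)
  have hwidth : 0 < C + 1 - -(C + 1) := by linarith
  have hc : c < 0 := neg_lt_zero.2 (by positivity)
  have hrange (x : X) : f x ∈ Set.Icc (-(C + 1)) (C + 1) :=
    ⟨by linarith [neg_le_of_abs_le (hC x)], by linarith [le_of_abs_le (hC x)]⟩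
  have hmeas (n : ℕ) : MeasurableSet {x : Fin n → X | ε ≤ 𝔼 i, f (x i) - ∫ y, f y ∂μ} := by
    simp only [Fintype.expect_eq_sum_div_card]
    exact measurableSet_le measurable_const (by fun_prop)
  have hbound (n : ℕ) : P {ω | ε ≤ 𝔼 i, f (A n ω i) - ∫ y, f y ∂μ} ≤
      ENNReal.ofReal (Real.exp (n * c)) := by
    rw [(hA n).measure_eq (p := fun x => ε ≤ 𝔼 i, f (x i) - ∫ y, f y ∂μ) (hmeas n),
      ← ofReal_measureReal]
    refine ENNReal.ofReal_le_ofReal ?_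
    simpa only [Fintype.card_fin] using measureReal_expect_sub_integral_ge_le (ι := Fin n)
      hf.aemeasurable (ae_of_all μ hrange) hε.le
  have hsum : ∑' n, P {ω | ε ≤ 𝔼 i, f (A n ω i) - ∫ y, f y ∂μ} ≠ ∞ :=
    ne_top_of_le_ne_top (Real.summable_exp_nat_mul_iff.2 hc).tsum_ofReal_ne_top
      (ENNReal.tsum_le_tsum hbound)
  filter_upwards [ae_eventually_notMem hsum] with ω hω
  filter_upwards [hω] with n hn
  exact not_le.1 hn

theorem ae_tendsto_expect
    (hA : ∀ n, HasLaw (A n) (Measure.pi fun _ => μ) P) {f : X → ℝ} (hf : Measurable f) {C : ℝ}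
    (hC : ∀ x, |f x| ≤ C) :
    ∀ᵐ ω ∂P, Tendsto (fun n => 𝔼 i, f (A n ω i)) atTop (𝓝 (∫ y, f y ∂μ)) := by
  have hupper : ∀ᵐ ω ∂P, ∀ m : ℕ, ∀ᶠ n in atTop,
      𝔼 i, f (A n ω i) - ∫ y, f y ∂μ < 1 / ((m : ℝ) + 1) :=
    ae_all_iff.2 fun m => ae_eventually_expect_sub_integral_lt hA hf hC Nat.one_div_pos_of_nat
  have hlower : ∀ᵐ ω ∂P, ∀ m : ℕ, ∀ᶠ n in atTop,
      𝔼 i, -f (A n ω i) - ∫ y, -f y ∂μ < 1 / ((m : ℝ) + 1) :=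
    ae_all_iff.2 fun m => ae_eventually_expect_sub_integral_lt hA hf.neg
      (fun x => (abs_neg (f x)).trans_le (hC x)) Nat.one_div_pos_of_nat
  filter_upwards [hupper, hlower] with ω hup hlo
  simp only [integral_neg, Finset.expect_neg_distrib] at hlo
  refine Metric.tendsto_nhds.2 fun ε hε => ?_
  obtain ⟨m, hm⟩ := exists_nat_one_div_lt hε
  filter_upwards [hup m, hlo m] with n hn hn'
  rw [Real.dist_eq, abs_lt]
  constructor <;> linarith

theorem ae_isEquidistributed_of_hasLaw_pi [TopologicalSpace X] [CompactSpace X]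
    [TopologicalSpace.MetrizableSpace X] [OpensMeasurableSpace X]
    (hA : ∀ n, HasLaw (A n) (Measure.pi fun _ => μ) P) :
    ∀ᵐ ω ∂P, IsEquidistributed (fun n => A n ω) μ := by
  obtain ⟨D, hcount, hdense⟩ := TopologicalSpace.exists_countable_dense C(X, ℝ)
  have hD : ∀ᵐ ω ∂P, ∀ f ∈ D, Tendsto (fun n => 𝔼 i, f (A n ω i)) atTop (𝓝 (∫ y, f y ∂μ)) :=
    (ae_ball_iff hcount).2 fun f _ => ae_tendsto_expect hA f.continuous.measurable
      f.norm_coe_le_norm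
  filter_upwards [hD] with ω hω using isEquidistributed_of_dense hdense hω

end Random

/-! ### Circles -/

theorem ae_add_mul_cos_add_mul_sin_ne_zero {A B C : ℝ} (h : ¬(A = 0 ∧ B = 0 ∧ C = 0)) :
    ∀ᵐ θ : ℝ, A + (B * Real.cos θ + C * Real.sin θ) ≠ 0 := by
  have hanalytic : AnalyticOnNhd ℝ (fun θ => A + (B * Real.cos θ + C * Real.sin θ)) Set.univ :=
    analyticOnNhd_const.add ((analyticOnNhd_const.mul Real.analyticOnNhd_cos).add
      (analyticOnNhd_const.mul Real.analyticOnNhd_sin))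
  obtain ⟨x, hx⟩ : ∃ x, A + (B * Real.cos x + C * Real.sin x) ≠ 0 := by
    by_contra! hzero
    have h₀ := hzero 0
    have hπ := hzero Real.pi
    have hπ₂ := hzero (Real.pi / 2)
    simp only [Real.cos_zero, Real.sin_zero, Real.cos_pi, Real.sin_pi, Real.cos_pi_div_two,
      Real.sin_pi_div_two] at h₀ hπ hπ₂
    exact h ⟨by linarith, by linarith, by linarith⟩
  have hcodiscrete := ae_restrict_le_codiscreteWithin (μ := volume) MeasurableSet.univ
    (hanalytic.preimage_zero_mem_codiscrete hx)
  rwa [Measure.restrict_univ] at hcodiscrete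

section CirclePoint

variable (b : OrthonormalBasis (Fin 3) ℝ E3) (r : ℝ)

theorem inner_circlePoint (θ : ℝ) (n : E3) :
    inner ℝ n (circlePoint b r θ : E3) = Real.cos r * inner ℝ n (b 0) +
      (Real.sin r * inner ℝ n (b 1) * Real.cos θ + Real.sin r * inner ℝ n (b 2) * Real.sin θ) := by
  simp only [circlePoint, inner_add_right, real_inner_smul_right]
  ring

theorem circlePoint_periodic : Function.Periodic (circlePoint b r) (2 * Real.pi) := fun θ =>
  Subtype.ext (by simp [circlePoint])

theorem lipschitzWith_circlePoint : LipschitzWith 2 (circlePoint b r) := by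
  refine LipschitzWith.of_dist_le_mul fun θ θ' => ?_
  have hsub : (circlePoint b r θ : E3) - circlePoint b r θ' =
      Real.sin r • ((Real.cos θ - Real.cos θ') • b 1 + (Real.sin θ - Real.sin θ') • b 2) := by
    simp only [circlePoint]
    module
  calc dist (circlePoint b r θ) (circlePoint b r θ')
      = |Real.sin r| *
          ‖(Real.cos θ - Real.cos θ') • b 1 + (Real.sin θ - Real.sin θ') • b 2‖ := by
        rw [Subtype.dist_eq, dist_eq_norm, hsub, norm_smul, Real.norm_eq_abs]
    _ ≤ ‖(Real.cos θ - Real.cos θ') • b 1 + (Real.sin θ - Real.sin θ') • b 2‖ :=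
        mul_le_of_le_one_left (norm_nonneg _) (Real.abs_sin_le_one r)
    _ ≤ |Real.cos θ - Real.cos θ'| + |Real.sin θ - Real.sin θ'| := by
        refine (norm_add_le _ _).trans_eq ?_
        simp only [norm_smul, b.norm_eq_one, mul_one, Real.norm_eq_abs]
    _ ≤ 2 * dist θ θ' := by
        rw [two_mul]
        exact add_le_add (Real.abs_cos_sub_cos_le θ θ') (Real.abs_sin_sub_sin_le θ θ')

theorem continuous_circlePoint : Continuous (circlePoint b r) :=
  (lipschitzWith_circlePoint b r).continuous

end CirclePoint

instance isProbabilityMeasure_circleUniform (c : S2) (r : ℝ) :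
    IsProbabilityMeasure (circleUniform c r) := by
  have : IsProbabilityMeasure
      (ProbabilityTheory.cond (volume : Measure ℝ) (Set.Ioc 0 (2 * Real.pi))) :=
    ProbabilityTheory.cond_isProbabilityMeasure_of_finite (by simp [Real.pi_pos])
      measure_Ioc_lt_top.ne
  exact Measure.isProbabilityMeasure_map (continuous_circlePoint _ r).aemeasurable

theorem nullOnGreatCircles_circleUniform (c : S2) {r : ℝ} (hr : Real.sin (2 * r) ≠ 0) :
    NullOnGreatCircles (circleUniform c r) := by
  intro n hn
  set b := (exists_basis_center c).choose
  have hcont : Continuous fun x : S2 => inner ℝ n (x : E3) := by fun_prop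
  have hmeas : MeasurableSet {x : S2 | inner ℝ n (x : E3) ≠ 0} :=
    (hcont.measurable (measurableSet_singleton 0)).compl
  refine (ae_map_iff (continuous_circlePoint b r).aemeasurable hmeas).2 ?_
  refine ProbabilityTheory.cond_absolutelyContinuous.ae_le ?_
  rw [Real.sin_two_mul, mul_ne_zero_iff, mul_ne_zero_iff] at hr
  obtain ⟨⟨-, hsin⟩, hcos⟩ := hr
  have hcoeff : ¬(Real.cos r * inner ℝ n (b 0) = 0 ∧ Real.sin r * inner ℝ n (b 1) = 0 ∧
      Real.sin r * inner ℝ n (b 2) = 0) := by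
    simp only [mul_eq_zero, hcos, hsin, false_or]
    rintro ⟨h₀, h₁, h₂⟩
    rw [← b.sum_repr' n, Fin.sum_univ_three, real_inner_comm, h₀, real_inner_comm, h₁,
      real_inner_comm, h₂] at hn
    simp at hn
  filter_upwards [ae_add_mul_cos_add_mul_sin_ne_zero hcoeff] with θ hθ
  rwa [inner_circlePoint]

/-! ### Change of parametrization of a circle -/

theorem exists_angle_of_sq_add_sq_eq_one {x y : ℝ} (h : x ^ 2 + y ^ 2 = 1) :
    ∃ α, x = Real.cos α ∧ y = Real.sin α := by
  have hnorm : ‖(⟨x, y⟩ : ℂ)‖ = 1 := by rw [Complex.norm_eq_sqrt_sq_add_sq, h, Real.sqrt_one]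
  have hne : (⟨x, y⟩ : ℂ) ≠ 0 := norm_ne_zero_iff.1 (hnorm ▸ one_ne_zero)
  exact ⟨Complex.arg ⟨x, y⟩, by rw [Complex.cos_arg hne, hnorm, div_one],
    by rw [Complex.sin_arg, hnorm, div_one]⟩

theorem exists_angle_of_orthonormal_pair {x y z w : ℝ} (hxy : x ^ 2 + y ^ 2 = 1)
    (hzw : z ^ 2 + w ^ 2 = 1) (horth : x * z + y * w = 0) :
    ∃ α, x = Real.cos α ∧ y = Real.sin α ∧
      (z = -Real.sin α ∧ w = Real.cos α ∨ z = Real.sin α ∧ w = -Real.cos α) := by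
  obtain ⟨α, rfl, rfl⟩ := exists_angle_of_sq_add_sq_eq_one hxy
  have hdet : (Real.cos α * w - Real.sin α * z) ^ 2 = 1 := by
    linear_combination (z ^ 2 + w ^ 2) * hxy + hzw -
      (Real.cos α * z + Real.sin α * w) * horth
  refine ⟨α, rfl, rfl, (sq_eq_one_iff.1 hdet).imp (fun h => ⟨?_, ?_⟩) fun h => ⟨?_, ?_⟩⟩
  · linear_combination Real.cos α * horth - z * hxy - Real.sin α * h
  · linear_combination Real.sin α * horth - w * hxy + Real.cos α * h
  · linear_combination Real.cos α * horth - z * hxy - Real.sin α * h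
  · linear_combination Real.sin α * horth - w * hxy + Real.cos α * h

section ChangeOfBasis

variable {b b' : OrthonormalBasis (Fin 3) ℝ E3}

theorem exists_angle_of_apply_zero_eq (h : b 0 = b' 0) :
    ∃ α, b' 1 = Real.cos α • b 1 + Real.sin α • b 2 ∧
      (b' 2 = -Real.sin α • b 1 + Real.cos α • b 2 ∨
        b' 2 = Real.sin α • b 1 - Real.cos α • b 2) := by
  have hzero (i : Fin 3) (hi : i ≠ 0) : inner ℝ (b 0) (b' i) = (0 : ℝ) := by
    rw [h]
    exact b'.orthonormal.2 hi.symm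
  have hexpand (i : Fin 3) (hi : i ≠ 0) :
      b' i = inner ℝ (b 1) (b' i) • b 1 + inner ℝ (b 2) (b' i) • b 2 := by
    conv_lhs => rw [← b.sum_repr' (b' i), Fin.sum_univ_three, hzero i hi, zero_smul, zero_add]
  have hparseval (i j : Fin 3) (hj : j ≠ 0) : inner ℝ (b 1) (b' i) * inner ℝ (b 1) (b' j) +
      inner ℝ (b 2) (b' i) * inner ℝ (b 2) (b' j) = inner ℝ (b' i) (b' j) := by
    simp only [← b.sum_inner_mul_inner (b' i) (b' j), Fin.sum_univ_three, hzero j hj,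
      real_inner_comm (b 1), real_inner_comm (b 2), mul_zero, zero_add]
  obtain ⟨α, hx, hy, hzw⟩ := exists_angle_of_orthonormal_pair
    (by simpa [sq] using hparseval 1 1 (by decide)) (by simpa [sq] using hparseval 2 2 (by decide))
    (by simpa using hparseval 1 2 (by decide))
  refine ⟨α, ?_, hzw.imp (fun hzw => ?_) fun hzw => ?_⟩
  · rw [hexpand 1 (by decide), hx, hy]
  · rw [hexpand 2 (by decide), hzw.1, hzw.2]
  · rw [hexpand 2 (by decide), hzw.1, hzw.2, neg_smul, sub_eq_add_neg]

theorem circlePoint_change_basis (h : b 0 = b' 0) (r : ℝ) :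
    ∃ α : ℝ, (∀ θ, circlePoint b' r θ = circlePoint b r (α + θ)) ∨
      ∀ θ, circlePoint b' r θ = circlePoint b r (α - θ) := by
  obtain ⟨α, h₁, h₂⟩ := exists_angle_of_apply_zero_eq h
  refine ⟨α, h₂.imp (fun h₂ θ => Subtype.ext ?_) fun h₂ θ => Subtype.ext ?_⟩
  · simp only [circlePoint, ← h, h₁, h₂, Real.cos_add, Real.sin_add]
    module
  · simp only [circlePoint, ← h, h₁, h₂, Real.cos_sub, Real.sin_sub]
    module

theorem integral_circlePoint_eq_of_apply_zero_eq {E : Type*} [NormedAddCommGroup E]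
    [NormedSpace ℝ E] (h : b 0 = b' 0) (r : ℝ) (f : S2 → E) :
    ∫ θ in 0..2 * Real.pi, f (circlePoint b r θ) =
      ∫ θ in 0..2 * Real.pi, f (circlePoint b' r θ) := by
  have hper : Function.Periodic (fun θ => f (circlePoint b r θ)) (2 * Real.pi) :=
    (circlePoint_periodic b r).comp f
  obtain ⟨α, hα | hα⟩ := circlePoint_change_basis h r
  · simp only [hα]
    rw [intervalIntegral.integral_comp_add_left (fun θ => f (circlePoint b r θ)), add_zero,
      hper.intervalIntegral_add_eq α 0, zero_add]
  · simp only [hα]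
    rw [intervalIntegral.integral_comp_sub_left (fun θ => f (circlePoint b r θ)), sub_zero,
      ← zero_add (2 * Real.pi), hper.intervalIntegral_add_eq 0 (α - 2 * Real.pi), zero_add,
      sub_add_cancel]

theorem integral_circleUniform {c : S2} (hb : b 0 = (c : E3)) (r : ℝ) (f : C(S2, ℝ)) :
    ∫ x, f x ∂circleUniform c r = ⨍ θ in 0..2 * Real.pi, f (circlePoint b r θ) := by
  rw [circleUniform, integral_map (continuous_circlePoint _ r).aemeasurable
    f.continuous.aestronglyMeasurable, ProbabilityTheory.cond, ← setAverage_eq',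
    ← Set.uIoc_of_le Real.two_pi_pos.le, interval_average_eq, interval_average_eq,
    integral_circlePoint_eq_of_apply_zero_eq (hb.trans (exists_basis_center c).choose_spec.symm)]

end ChangeOfBasis

/-! ### Evenly spaced points -/

theorem abs_sub_mul_sub_intervalIntegral_le {g : ℝ → ℝ} {a b ε : ℝ} (hab : a ≤ b)
    (hg : IntervalIntegrable g volume a b) (h : ∀ θ ∈ Set.Ioc a b, |g a - g θ| ≤ ε) :
    |(b - a) * g a - ∫ θ in a..b, g θ| ≤ ε * (b - a) := by
  have hconst : (b - a) * g a = ∫ _ in a..b, g a := by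
    rw [intervalIntegral.integral_const, smul_eq_mul]
  rw [hconst, ← intervalIntegral.integral_sub intervalIntegrable_const hg,
    ← abs_of_nonneg (sub_nonneg.2 hab)]
  rw [← Set.uIoc_of_le hab] at h
  exact intervalIntegral.norm_integral_le_of_norm_le_const (f := fun θ => g a - g θ) h

theorem abs_sum_sub_mul_sub_intervalIntegral_le {g : ℝ → ℝ} (hg : Continuous g) {a : ℕ → ℝ}
    (ha : Monotone a) {ε : ℝ} (n : ℕ)
    (h : ∀ j, ∀ θ ∈ Set.Ioc (a j) (a (j + 1)), |g (a j) - g θ| ≤ ε) :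
    |∑ j ∈ Finset.range n, (a (j + 1) - a j) * g (a j) - ∫ θ in a 0..a n, g θ| ≤
      ε * (a n - a 0) := by
  rw [← intervalIntegral.sum_integral_adjacent_intervals fun j _ => hg.intervalIntegrable _ _,
    ← Finset.sum_sub_distrib, ← Finset.sum_range_sub, Finset.mul_sum]
  exact (Finset.abs_sum_le_sum_abs _ _).trans (Finset.sum_le_sum fun j _ =>
    abs_sub_mul_sub_intervalIntegral_le (ha j.le_succ) (hg.intervalIntegrable _ _) (h j))

theorem abs_expect_sub_intervalAverage_le {g : ℝ → ℝ} (hg : Continuous g) {T : ℝ} (hT : 0 < T)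
    {n : ℕ} (hn : n ≠ 0) {ε : ℝ} (h : ∀ θ θ', |θ - θ'| ≤ T / n → |g θ - g θ'| ≤ ε) :
    |𝔼 j : Fin n, g (T * j / n) - ⨍ θ in 0..T, g θ| ≤ ε := by
  have hn₀ : (n : ℝ) ≠ 0 := Nat.cast_ne_zero.2 hn
  have hstep (j : ℕ) : T * (j + 1 : ℕ) / n - T * j / n = T / n := by
    push_cast
    ring
  have hsum := abs_sum_sub_mul_sub_intervalIntegral_le hg (a := fun j : ℕ => T * j / n)
    (ε := ε) (monotone_nat_of_le_succ fun j => sub_nonneg.1 (by rw [hstep]; positivity)) n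
    fun j θ hθ => h _ _ (by rw [abs_le]; constructor <;> linarith [hstep j, hθ.1, hθ.2])
  simp only [hstep, Nat.cast_zero, mul_zero, zero_div, mul_div_cancel_right₀ T hn₀, sub_zero,
    ← Finset.mul_sum] at hsum
  rw [Fintype.expect_eq_sum_div_card, Fintype.card_fin, interval_average_eq_div, sub_zero,
    Fin.sum_univ_eq_sum_range (fun j : ℕ => g (T * j / n)) n]
  have hscale : ∀ S J : ℝ, S / n - J / T = (T / n * S - J) / T := fun S J => by field_simp
  rwa [hscale, abs_div, abs_of_pos hT, div_le_iff₀ hT]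

theorem isEquidistributed_circleUniform {c : S2} {r : ℝ} {p : ∀ n : ℕ, Fin n → S2}
    (hp : ∀ n, EvenlySpaced c r (p n)) : IsEquidistributed p (circleUniform c r) := by
  refine fun f => Metric.tendsto_atTop'.2 fun ε hε => ?_
  obtain ⟨δ, hδ, hf⟩ := Metric.uniformContinuous_iff.1
    (CompactSpace.uniformContinuous_of_continuous f.continuous) (ε / 2) (half_pos hε)
  obtain ⟨N, hN⟩ := exists_nat_gt (2 * (2 * Real.pi) / δ)
  refine ⟨N, fun n hn => ?_⟩
  obtain ⟨b, hb, hpb⟩ := hp n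
  have hn₀ : (0 : ℝ) < n := Nat.cast_pos.2 (Nat.zero_lt_of_lt hn)
  have hmesh : 2 * (2 * Real.pi / n) < δ := by
    have hδn := hN.trans (Nat.cast_lt.2 hn)
    rw [div_lt_iff₀ hδ] at hδn
    rwa [← mul_div_assoc, div_lt_iff₀' hn₀]
  simp only [hpb]
  rw [Real.dist_eq, integral_circleUniform hb]
  refine (abs_expect_sub_intervalAverage_le (g := fun θ => f (circlePoint b r θ))
    (f.continuous.comp (continuous_circlePoint b r)) Real.two_pi_pos (Nat.cast_ne_zero.1 hn₀.ne')
    fun θ θ' hθ => (hf ?_).le).trans_lt (half_lt_self hε)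
  calc dist (circlePoint b r θ) (circlePoint b r θ')
      ≤ 2 * |θ - θ'| := (lipschitzWith_circlePoint b r).dist_le_mul θ θ'
    _ ≤ 2 * (2 * Real.pi / n) := by gcongr
    _ < δ := hmesh

/-! ### Mixtures of circles -/

section CircleMixture

variable {ι : Type*} [Fintype ι]

/-- The law of a uniformly random point of a uniformly chosen circle of a finite family, with
centres `c i` and spherical radii `r i`. -/
def circleMixture (c : ι → S2) (r : ι → ℝ) : Measure S2 :=
  (Fintype.card ι : ℝ≥0∞)⁻¹ • ∑ i, circleUniform (c i) (r i)

theorem fourCirclesUniform_eq_circleMixture (c : Fin 4 → S2) (r : ℝ) :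
    fourCirclesUniform c r = circleMixture c fun _ => r := by
  simp [fourCirclesUniform, circleMixture]

instance isProbabilityMeasure_circleMixture [Nonempty ι] (c : ι → S2) (r : ι → ℝ) :
    IsProbabilityMeasure (circleMixture c r) where
  measure_univ := by simp [circleMixture, ENNReal.inv_mul_cancel]

theorem nullOnGreatCircles_circleMixture (c : ι → S2) {r : ι → ℝ}
    (hr : ∀ i, Real.sin (2 * r i) ≠ 0) : NullOnGreatCircles (circleMixture c r) := by
  intro n hn
  refine Measure.smul_absolutelyContinuous.ae_le ?_
  rw [← Measure.sum_fintype]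
  exact Measure.ae_sum_iff.2 fun i => nullOnGreatCircles_circleUniform (c i) (hr i) n hn

theorem integral_circleMixture (c : ι → S2) (r : ι → ℝ) (f : C(S2, ℝ)) :
    ∫ x, f x ∂circleMixture c r = 𝔼 i, ∫ x, f x ∂circleUniform (c i) (r i) := by
  rw [circleMixture, integral_smul_measure, integral_finsetSum_measure fun i _ =>
    f.continuous.integrable_of_hasCompactSupport (.of_compactSpace f),
    Fintype.expect_eq_sum_div_card, div_eq_inv_mul]
  simp

theorem isEquidistributed_circleMixture {c : ι → S2} {r : ι → ℝ} {p : ∀ n : ℕ, ι × Fin n → S2}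
    (hp : ∀ n i, EvenlySpaced (c i) (r i) fun j => p n (i, j)) :
    IsEquidistributed p (circleMixture c r) := by
  intro f
  rw [integral_circleMixture, Fintype.expect_eq_sum_div_card]
  refine ((tendsto_finsetSum Finset.univ fun i _ =>
    isEquidistributed_circleUniform (fun n => hp n i) f).div_const _).congr fun n => ?_
  rw [← Fintype.expect_eq_sum_div_card (fun i => 𝔼 j, f (p n (i, j))),
    ← Finset.univ_product_univ, Finset.expect_product]

end CircleMixture

/-! ### Graphons of relations -/

open scoped Classical in
/-- The `{0, 1}`-valued graphon of a symmetric measurable relation on the unit interval. -/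
def Graphon.ofRel (R : Set (I × I)) (hR : MeasurableSet R)
    (hsymm : ∀ s t, (s, t) ∈ R ↔ (t, s) ∈ R) : Graphon where
  toFun s t := if (s, t) ∈ R then 1 else 0
  measurable := measurable_const.ite hR measurable_const
  symm s t := by simp only [hsymm s t]
  nonneg s t := by split_ifs <;> norm_num
  le_one s t := by split_ifs <;> norm_num

theorem mem_homSet_iff_of_symm {X V : Type*} [LinearOrder V] {H : SimpleGraph V} {R : Set (X × X)}
    (hsymm : ∀ s t, (s, t) ∈ R ↔ (t, s) ∈ R) {x : V → X} :
    x ∈ homSet H R ↔ ∀ i j, i < j → H.Adj i j → (x i, x j) ∈ R := by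
  refine ⟨fun h i j _ => h i j, fun h i j hij => ?_⟩
  rcases hij.ne.lt_or_gt with hlt | hgt
  · exact h i j hlt hij
  · exact (hsymm _ _).1 (h j i hgt hij.symm)

theorem Graphon.homDensity_ofRel {R : Set (I × I)} (hR : MeasurableSet R)
    (hsymm : ∀ s t, (s, t) ∈ R ↔ (t, s) ∈ R) {k : ℕ} (H : SimpleGraph (Fin k)) :
    (Graphon.ofRel R hR hsymm).homDensity H = (volume : Measure (Fin k → I)).real (homSet H R) := by
  classical
  rw [← integral_indicator_one (measurableSet_homSet H hR), Graphon.homDensity]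
  congr 1 with x
  simp only [ofRel, Finset.prod_ite_zero, Finset.prod_const_one, Set.indicator_apply, Pi.one_apply]
  refine if_congr ?_ rfl rfl
  simp only [mem_homSet_iff_of_symm hsymm, Finset.mem_filter_univ, Prod.forall, and_imp]

theorem exists_graphon_homDensity_eq {X : Type*} [MeasurableSpace X] [StandardBorelSpace X]
    (μ : Measure X) [IsProbabilityMeasure μ] {R : Set (X × X)} (hR : MeasurableSet R)
    (hsymm : ∀ x y, (x, y) ∈ R ↔ (y, x) ∈ R) :
    ∃ W : Graphon, ∀ (k : ℕ) (H : SimpleGraph (Fin k)),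
      W.homDensity H = (Measure.pi fun _ : Fin k => μ).real (homSet H R) := by
  have := nonempty_of_isProbabilityMeasure μ
  obtain ⟨φ, hφ, hmap⟩ := μ.exists_measurable_map_eq
  have hpreimage : MeasurableSet (Prod.map φ φ ⁻¹' R) := hφ.prodMap hφ hR
  refine ⟨.ofRel _ hpreimage fun s t => hsymm (φ s) (φ t), fun k H => ?_⟩
  have hpres : MeasurePreserving (fun (x : Fin k → I) i => φ (x i)) volume
      (Measure.pi fun _ => μ) :=
    measurePreserving_pi (fun _ => volume) (fun _ => μ) fun _ => ⟨hφ, hmap⟩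
  rw [Graphon.homDensity_ofRel,
    ← hpres.measureReal_preimage (measurableSet_homSet H hR).nullMeasurableSet]
  rfl

/-! ### Crossing graphons -/

section CrossingGraphon

variable {μ ν : Measure S2} [IsProbabilityMeasure μ] [IsProbabilityMeasure ν]

theorem exists_graphon_homDensity_eq_crossingDensity (μ ν : Measure S2) [IsProbabilityMeasure μ]
    [IsProbabilityMeasure ν] : ∃ W : Graphon, ∀ (k : ℕ) (H : SimpleGraph (Fin k)),
      W.homDensity H = crossingDensity μ ν H :=
  exists_graphon_homDensity_eq (μ.prod ν) isOpen_properCrossings.measurableSet fun p q => by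
    simp only [properCrossings, Set.mem_ofPred_eq, crossingDefect_comm p q]

theorem ae_tendsto_homDensity_crossingGraph {Ω : Type*} [MeasurableSpace Ω] {P : Measure Ω}
    (hμ : NullOnGreatCircles μ) (hν : NullOnGreatCircles ν) {A B : ∀ n : ℕ, Ω → Fin n → S2}
    (h : ∀ n, HasLaw (fun ω => (A n ω, B n ω))
      ((Measure.pi fun _ => μ).prod (Measure.pi fun _ => ν)) P) :
    ∀ᵐ ω ∂P, ∀ (k : ℕ) (H : SimpleGraph (Fin k)),
      Tendsto (fun n => homDensity H (crossingGraph (A n ω) (B n ω))) atTop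
        (𝓝 (crossingDensity μ ν H)) := by
  have hA : ∀ᵐ ω ∂P, IsEquidistributed (fun n => A n ω) μ :=
    ae_isEquidistributed_of_hasLaw_pi fun n => measurePreserving_fst.fun_comp_hasLaw (h n)
  have hB : ∀ᵐ ω ∂P, IsEquidistributed (fun n => B n ω) ν :=
    ae_isEquidistributed_of_hasLaw_pi fun n => measurePreserving_snd.fun_comp_hasLaw (h n)
  filter_upwards [hA, hB] with ω hA hB k H
  exact hA.tendsto_homDensity_crossingGraph hμ hν hB H

theorem exists_isCrossingGraphon (hμ : NullOnGreatCircles μ) (hν : NullOnGreatCircles ν) :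
    ∃ W : Graphon, IsCrossingGraphon μ ν W := by
  obtain ⟨W, hW⟩ := exists_graphon_homDensity_eq_crossingDensity μ ν
  refine ⟨W, fun Ω _ P _ A B h => ?_⟩
  simp only [ConvergesToGraphon, hW]
  exact ae_tendsto_homDensity_crossingGraph hμ hν h

theorem IsCrossingGraphon.homDensity_eq_crossingDensity (hμ : NullOnGreatCircles μ)
    (hν : NullOnGreatCircles ν) {W : Graphon} (hW : IsCrossingGraphon μ ν W) {k : ℕ}
    (H : SimpleGraph (Fin k)) : W.homDensity H = crossingDensity μ ν H := by
  let P := Measure.infinitePi fun n : ℕ =>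
    (Measure.pi fun _ : Fin n => μ).prod (Measure.pi fun _ : Fin n => ν)
  have hlaw (n : ℕ) : HasLaw (fun ω : ∀ n : ℕ, (Fin n → S2) × (Fin n → S2) => ((ω n).1, (ω n).2))
      ((Measure.pi fun _ => μ).prod (Measure.pi fun _ => ν)) P :=
    ⟨(measurable_pi_apply n).aemeasurable, Measure.infinitePi_map_eval _ n⟩
  obtain ⟨ω, hω, hω'⟩ := ((hW _ P (fun n ω => (ω n).1) (fun n ω => (ω n).2) hlaw).and
    (ae_tendsto_homDensity_crossingGraph hμ hν hlaw)).exists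
  exact tendsto_nhds_unique (hω k H) (hω' k H)

theorem IsCrossingGraphon.convergesToGraphon (hμ : NullOnGreatCircles μ)
    (hν : NullOnGreatCircles ν) {W : Graphon} (hW : IsCrossingGraphon μ ν W)
    {ι κ : ℕ → Type} [∀ n, Fintype (ι n)] [∀ n, Fintype (κ n)] [∀ n, Nonempty (ι (n + 1))]
    [∀ n, Nonempty (κ (n + 1))] {a : ∀ n, ι n → S2} {b : ∀ n, κ n → S2}
    (ha : IsEquidistributed a μ) (hb : IsEquidistributed b ν) :
    ConvergesToGraphon (fun n => crossingGraph (a n) (b n)) W := fun k H => by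
  rw [hW.homDensity_eq_crossingDensity hμ hν]
  exact ha.tendsto_homDensity_crossingGraph hμ hν hb H

end CrossingGraphon

theorem theorem5_general {ι κ : Type} [Fintype ι] [Nonempty ι] [Fintype κ] [Nonempty κ]
    {c : ι → S2} {d : κ → S2} {r : ι → ℝ} {s : κ → ℝ} (hr : ∀ i, Real.sin (2 * r i) ≠ 0)
    (hs : ∀ j, Real.sin (2 * s j) ≠ 0) :
    (∃ W : Graphon, IsCrossingGraphon (circleMixture c r) (circleMixture d s) W) ∧
    ∀ W : Graphon, IsCrossingGraphon (circleMixture c r) (circleMixture d s) W →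
      ∀ (A : ∀ n : ℕ, ι × Fin n → S2) (B : ∀ n : ℕ, κ × Fin n → S2),
        (∀ n i, EvenlySpaced (c i) (r i) fun j => A n (i, j)) →
        (∀ n i, EvenlySpaced (d i) (s i) fun j => B n (i, j)) →
        ConvergesToGraphon (fun n => crossingGraph (A n) (B n)) W :=
  have hμ := nullOnGreatCircles_circleMixture c hr
  have hν := nullOnGreatCircles_circleMixture d hs
  ⟨exists_isCrossingGraphon hμ hν, fun _ hW _ _ hA hB => hW.convergesToGraphon hμ hν
    (isEquidistributed_circleMixture hA) (isEquidistributed_circleMixture hB)⟩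

end

theorem theorem5 (r : ℝ) (hr₀ : 0 < r) (hr : r < Real.pi / 2) (v₁ v₂ w₁ w₂ : S2)
    (hD : Function.Injective (Sum.elim (antipodalPairs v₁ v₂) (antipodalPairs w₁ w₂))) :
    (∃ W : Graphon, IsCrossingGraphon (fourCirclesUniform (antipodalPairs v₁ v₂) r)
      (fourCirclesUniform (antipodalPairs w₁ w₂) r) W) ∧
    ∀ W : Graphon, IsCrossingGraphon (fourCirclesUniform (antipodalPairs v₁ v₂) r)
        (fourCirclesUniform (antipodalPairs w₁ w₂) r) W →
      ∀ A B : ∀ n : ℕ, Fin 4 × Fin n → S2,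
        (∀ n, IsBlowup n (antipodalPairs v₁ v₂) (antipodalPairs w₁ w₂) r (A n) (B n)) →
        ConvergesToGraphon (fun n => crossingGraph (A n) (B n)) W := by
  have hsin : Real.sin (2 * r) ≠ 0 :=
    (Real.sin_pos_of_pos_of_lt_pi (by linarith) (by linarith)).ne'
  simp only [fourCirclesUniform_eq_circleMixture]
  exact (theorem5_general (fun _ => hsin) fun _ => hsin).imp_right fun h W hW A B hAB =>
    h W hW A B (fun n => (hAB n).left) fun n => (hAB n).right
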